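/- Let $(\mathcal X,\mathcal F,\mu)$ and $(\mathcal Y,\mathcal G,\nu)$ be probability spaces with $(\mathcal X,\mathcal F)$, $(\mathcal Y,\mathcal G)$ standard Borel, and let $\lambda=\mu\times\nu$. Let $\mathcal P$ be the set of probability measures on $\mathcal F\otimes\mathcal G$ with the $\sigma$-field $\Psi$ generated by the maps $p\mapsto p(H)$, $H\in\mathcal F\otimes\mathcal G$. Let $\Gamma(\mu,\nu)\subset\mathcal P$ be the set of those $p$ with marginals $\mu$ on $\mathcal F$ and $\nu$ on $\mathcal G$, and $\mathcal P_0=\{p\in\Gamma(\mu,\nu):p\ll\lambda\}$. Let $\mathcal D$ be the set of probability densities $f$ with respect to $\lambda$ such that $P_f\in\Gamma(\mu,\nu)$, where $P_f(H)=\int_H f\,d\lambda$, with the $\sigma$-field $\Psi^*$ generated by $f\mapsto P_f$. A random density is a random element of $(\mathcal D,\Psi^*)$. Let $Z_1,Z_2,\ldots$ be random variables with values in $(\mathcal X\times\mathcal Y,\mathcal F\otimes\mathcal G)$; they and all random densities are defined on one probability space $(\Omega,\mathcal A,\mathbb P)$. A prior of $(Z_n)$ is a probability measure $\Pi$ on $\Psi$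 such that $\mathbb P(Z_1\in H_1,\ldots,Z_k\in H_k)=\int p(H_1)\cdots p(H_k)\,\Pi(dp)$ for all $k$ and $H_1,\ldots,H_k\in\mathcal F\otimes\mathcal G$. For a random density $f$, "$(Z_n)\mid f$ is i.i.d. with $Z_1\sim f$" means that $\mathbb P(Z_1\in H_1,\ldots,Z_k\in H_k\mid f)=\prod_{i=1}^k P_f(H_i)$ a.s. for all such $k$ and $H_i$. A posterior on $\mathcal D$ given $Z_1,\ldots,Z_n$ is a probability kernel $\Pi(\cdot\mid Z_1,\ldots,Z_n)$ on $(\mathcal D,\Psi^*)$ such that $$\mathbb P(Z_{n+1}\in H_1,\ldots,Z_{n+k}\in H_k\mid Z_1,\ldots,Z_n)=\int \prod_{i=1}^kP_\phi(H_i)\,\Pi(d\phi\mid Z_1,\ldots,Z_n)\quad\text{a.s.}$$ for all such $k$ and $H_i$. (i) If $(Z_n)$ is exchangeable, it has exactly one prior. (ii) $(Z_n)$ is exchangeable with prior concentrated on $\mathcal P_0$ (that is, its prior $\Pi$ satisfies $\Pi(\mathcal P_0)=1$) if and only if there is a random density $f$ such that $(Z_n)\mid f$ is i.i.d. with $Z_1\sim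 f$. (iii) Let $f$ be a random density as in (ii), and let $\Pi$ be its distribution on $(\mathcal D,\Psi^*)$. There is a jointly measurable version of the evaluation map, that is, a jointly measurable map $(\phi,z)\mapsto\tilde\phi(z)\in[0,\infty)$ on $\mathcal D\times(\mathcal X\times\mathcal Y)$ with $\tilde\phi=\phi$ $\lambda$-a.e. for $\Pi$-almost every $\phi$. For every $n\ge 0$ a posterior given $Z_1,\ldots,Z_n$ exists, and for every jointly measurable version and every posterior, almost surely, $$\Pi(d\phi\mid Z_1,\ldots,Z_n)=\frac{\prod_{i=1}^n\tilde\phi(Z_i)}{\int\prod_{i=1}^n\tilde\psi(Z_i)\,\Pi(d\psi)}\,\Pi(d\phi)$$ whenever $\int\prod_{i=1}^n\tilde\psi(Z_i)\,\Pi(d\psi)\in(0,\infty)$. -/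

import Mathlib

open MeasureTheory ProbabilityTheory
open scoped NNReal ENNReal

/-- The sequence `Z 0, Z 1, …` is exchangeable under `P`: for every `n`, permuting the first `n`
variables does not change their joint law. -/
def Exchangeable {Ω S : Type*} [MeasurableSpace Ω] [MeasurableSpace S]
    (P : Measure Ω) (Z : ℕ → Ω → S) : Prop :=
  ∀ (n : ℕ) (σ : Equiv.Perm (Fin n)),
    P.map (fun ω (i : Fin n) => Z (σ i) ω) = P.map (fun ω (i : Fin n) => Z i ω)

/-- `Π` is a de Finetti measure (prior distribution) of `Z`: a probability measure on the space of
probability measures, with the `σ`-field generated by the evaluations, such that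
`P(Z 0 ∈ H 0, …, Z (k-1) ∈ H (k-1)) = ∫ p(H 0) ⋯ p(H (k-1)) Π(dp)`. -/
def IsPrior {Ω S : Type*} [MeasurableSpace Ω] [MeasurableSpace S]
    (P : Measure Ω) (Z : ℕ → Ω → S) (Pr : Measure (ProbabilityMeasure S)) : Prop :=
  IsProbabilityMeasure Pr ∧
    ∀ (k : ℕ) (H : Fin k → Set S), (∀ i, MeasurableSet (H i)) →
      P (⋂ i : Fin k, Z i ⁻¹' H i) = ∫⁻ p, ∏ i, (p : Measure S) (H i) ∂Pr

/-- The Fréchet class `Γ(μ, ν)`: probability measures with marginals `μ` and `ν`. -/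
def FrechetClass {X Y : Type*} [MeasurableSpace X] [MeasurableSpace Y]
    (μ : Measure X) (ν : Measure Y) : Set (ProbabilityMeasure (X × Y)) :=
  {p | (p : Measure (X × Y)).map Prod.fst = μ ∧ (p : Measure (X × Y)).map Prod.snd = ν}

/-- The class `P₀` of those `p ∈ Γ(μ, ν)` that are absolutely continuous w.r.t. `μ × ν`. -/
def FrechetClassAC {X Y : Type*} [MeasurableSpace X] [MeasurableSpace Y]
    (μ : Measure X) (ν : Measure Y) : Set (ProbabilityMeasure (X × Y)) :=
  {p | p ∈ FrechetClass μ ν ∧ (p : Measure (X × Y)) ≪ μ.prod ν}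

/-- A probability density `g` w.r.t. `μ × ν`, as a function on `X × Y`. -/
structure ProdDensity {X Y : Type*} [MeasurableSpace X] [MeasurableSpace Y]
    (μ : Measure X) (ν : Measure Y) where
  toFun : X × Y → ℝ≥0
  measurable_toFun : Measurable toFun
  lintegral_eq_one : ∫⁻ z, (toFun z : ℝ≥0∞) ∂(μ.prod ν) = 1

/-- The probability measure `P_g(H) = ∫_H g d(μ × ν)`. -/
noncomputable def ProdDensity.law {X Y : Type*} [MeasurableSpace X] [MeasurableSpace Y]
    {μ : Measure X} {ν : Measure Y} (g : ProdDensity μ ν) : ProbabilityMeasure (X × Y) :=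
  ⟨(μ.prod ν).withDensity (fun z => (g.toFun z : ℝ≥0∞)),
    ⟨by rw [withDensity_apply _ MeasurableSet.univ, Measure.restrict_univ, g.lintegral_eq_one]⟩⟩

/-- The set `𝒟` of the probability densities `g` w.r.t. `μ × ν` such that `P_g ∈ Γ(μ, ν)`. -/
def FrechetDensity {X Y : Type*} [MeasurableSpace X] [MeasurableSpace Y]
    (μ : Measure X) (ν : Measure Y) : Type _ :=
  {g : ProdDensity μ ν // g.law ∈ FrechetClass μ ν}

/-- The values of a density `g ∈ 𝒟`. -/
def FrechetDensity.eval {X Y : Type*} [MeasurableSpace X] [MeasurableSpace Y]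
    {μ : Measure X} {ν : Measure Y} (g : FrechetDensity μ ν) : X × Y → ℝ≥0 :=
  g.1.toFun

/-- The map `g ↦ P_g` on `𝒟`. -/
noncomputable def FrechetDensity.law {X Y : Type*} [MeasurableSpace X] [MeasurableSpace Y]
    {μ : Measure X} {ν : Measure Y} (g : FrechetDensity μ ν) : ProbabilityMeasure (X × Y) :=
  g.1.law

/-- The `σ`-field on `𝒟` generated by the map `g ↦ P_g`. -/
noncomputable instance FrechetDensity.instMeasurableSpace {X Y : Type*} [MeasurableSpace X]
    [MeasurableSpace Y] {μ : Measure X} {ν : Measure Y} : MeasurableSpace (FrechetDensity μ ν) :=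
  MeasurableSpace.comap FrechetDensity.law inferInstance

/-- `f` is a random density (a random element of `𝒟`) and, conditionally on `f`, the sequence `Z`
is i.i.d. with `Z 0 ∼ f`. -/
def IsCondIID {Ω X Y : Type*} [MeasurableSpace Ω] [MeasurableSpace X] [MeasurableSpace Y]
    {μ : Measure X} {ν : Measure Y} (P : Measure Ω) (Z : ℕ → Ω → X × Y)
    (f : Ω → FrechetDensity μ ν) : Prop :=
  Measurable f ∧
    ∀ (k : ℕ) (H : Fin k → Set (X × Y)), (∀ i, MeasurableSet (H i)) →
      P⟦⋂ i : Fin k, Z i ⁻¹' H i | MeasurableSpace.comap f inferInstance⟧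
        =ᵐ[P] fun ω => ∏ i, ((f ω).law : Measure (X × Y)).real (H i)

/-- The first `n` observations. -/
def observations {Ω S : Type*} (Z : ℕ → Ω → S) (n : ℕ) (ω : Ω) : Fin n → S :=
  fun i => Z i ω

/-- `Q(· | z)`, as a function of the value `z` of the first `n` observations, is a posterior
distribution on `𝒟` given these observations: a Markov kernel such that almost surely
`P(Z n ∈ H 0, …, Z (n+k-1) ∈ H (k-1) | Z 0, …, Z (n-1))`
equals `∫ P_g(H 0) ⋯ P_g(H (k-1)) Q(dg | Z 0, …, Z (n-1))`. -/
def IsPosterior {Ω X Y : Type*} [MeasurableSpace Ω] [MeasurableSpace X] [MeasurableSpace Y]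
    {μ : Measure X} {ν : Measure Y} (P : Measure Ω) (Z : ℕ → Ω → X × Y) (n : ℕ)
    (Q : Kernel (Fin n → X × Y) (FrechetDensity μ ν)) : Prop :=
  IsMarkovKernel Q ∧
    ∀ (k : ℕ) (H : Fin k → Set (X × Y)), (∀ i, MeasurableSet (H i)) →
      P⟦⋂ i : Fin k, Z (n + i) ⁻¹' H i |
          MeasurableSpace.comap (observations Z n) inferInstance⟧
        =ᵐ[P] fun ω => ∫ g, ∏ i, (g.law : Measure (X × Y)).real (H i) ∂(Q (observations Z n ω))

/-- A jointly measurable version `φ` of the evaluation `(g, z) ↦ g z` on `𝒟 × (X × Y)`, for a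
distribution `Pr` on `𝒟`. As the `σ`-field of `𝒟` does not separate densities that agree
almost everywhere, `g ↦ g z` itself is in general not measurable for fixed `z`. -/
def IsJointVersion {X Y : Type*} [MeasurableSpace X] [MeasurableSpace Y]
    {μ : Measure X} {ν : Measure Y} (Pr : Measure (FrechetDensity μ ν))
    (φ : FrechetDensity μ ν → X × Y → ℝ≥0) : Prop :=
  Measurable (Function.uncurry φ) ∧ ∀ᵐ g ∂Pr, φ g =ᵐ[μ.prod ν] g.eval

/-- The likelihood `∏ φ(z i)` of the observations `z`. -/
def likelihood {X Y : Type*} [MeasurableSpace X] [MeasurableSpace Y]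
    {μ : Measure X} {ν : Measure Y} (φ : FrechetDensity μ ν → X × Y → ℝ≥0) {n : ℕ}
    (z : Fin n → X × Y) (g : FrechetDensity μ ν) : ℝ≥0∞ :=
  ((∏ i, φ g (z i) : ℝ≥0) : ℝ≥0∞)

/-! Uniqueness, of priors and of posteriors, is a moment problem. Along a countable generating
π-system a probability measure becomes a point of a countable power of `[0,1]`. Products of masses
become monomials, which determine a mixing measure by a Stone–Weierstrass argument
(`measure_eq_of_forall_integral_prod_basicSet_eq`).

Existence in de Finetti's theorem uses an L² argument instead of reverse martingales. Let `κ` be the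
conditional law of `Z 0` given `Z 1, Z 2, …`. By contractability the same `κ` is the conditional law
of `Z j` given `Z n, Z (n+1), …` whenever `j < n`. Hence, for fixed `H`, the mass of `H` under `κ`
at the tail from `n` is an orthogonal projection of the mass at the tail from `1`. The two have
equal norms, so they agree a.s. The directing measure is thus a function of every tail, and the
observations can be integrated out one at a time.

If the prior charges only `P₀`, a density of the directing measure is the required `f`. Choosing it
is harmless, because the `σ`-field of `𝒟` is pulled back from the laws. For Bayes' formula, the
joint law of observations and `f` has the likelihood as density with respect to `λⁿ × Π`.
Normalising disintegrates it, which gives one posterior, and moment uniqueness identifies all others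
with it a.s. -/

/-! ### Mixtures of probability measures are determined by mixed moments. -/

section MomentUniqueness

open BoundedContinuousFunction

/-- The coordinate functions on a power of the unit interval. -/
def unitCubeCoord {ι : Type*} (i : ι) : (ι → unitInterval) →ᵇ ℝ :=
  BoundedContinuousFunction.mkOfCompact ⟨fun x => (x i : ℝ), by fun_prop⟩

@[simp]
lemma unitCubeCoord_apply {ι : Type*} (i : ι) (x : ι → unitInterval) :
    unitCubeCoord i x = (x i : ℝ) := rfl

lemma exists_eq_prod_of_mem_closure_unitCubeCoord {ι : Type*} {g : (ι → unitInterval) →ᵇ ℝ}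
    (hg : g ∈ Submonoid.closure (Set.range (unitCubeCoord (ι := ι)))) :
    ∃ (k : ℕ) (c : Fin k → ι), ∀ x, g x = ∏ i, (x (c i) : ℝ) := by
  induction hg using Submonoid.closure_induction with
  | mem g hg =>
    obtain ⟨i, rfl⟩ := hg
    exact ⟨1, fun _ => i, fun x => by simp⟩
  | one => exact ⟨0, Fin.elim0, fun x => by simp⟩
  | mul g h _ _ hg hh =>
    obtain ⟨k, c, hc⟩ := hg
    obtain ⟨l, d, hd⟩ := hh
    exact ⟨k + l, Fin.append c d, fun x => by simp [Fin.prod_univ_add, hc, hd]⟩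

/-- Finite measures on a countable power of the unit interval are determined by their mixed
moments. -/
theorem measure_unitCube_ext {ι : Type*} [Countable ι] {π₁ π₂ : Measure (ι → unitInterval)}
    [IsFiniteMeasure π₁] [IsFiniteMeasure π₂]
    (h : ∀ (k : ℕ) (c : Fin k → ι),
      ∫ x, ∏ i, (x (c i) : ℝ) ∂π₁ = ∫ x, ∏ i, (x (c i) : ℝ) ∂π₂) : π₁ = π₂ := by
  let s : Set ((ι → unitInterval) →ᵇ ℝ) := Set.range unitCubeCoord
  refine ext_of_forall_mem_subalgebra_integral_eq_of_polish (𝕜 := ℝ)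
    (A := StarAlgebra.adjoin ℝ s) ?_ ?_
  · intro x y hxy
    obtain ⟨i, hi⟩ := Function.ne_iff.1 hxy
    refine ⟨unitCubeCoord i, ⟨(unitCubeCoord i).toContinuousMap,
      ⟨unitCubeCoord i, StarAlgebra.subset_adjoin ℝ s ⟨i, rfl⟩, rfl⟩, rfl⟩, ?_⟩
    simpa [Subtype.ext_iff] using hi
  · intro g hg
    -- Real coordinates are self-adjoint, so the star algebra they generate is just the linear span
    -- of the monomials.
    have hstar : star s = s := by
      ext g
      have : star g = g := by ext x; simp
      rw [Set.mem_star, this]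
    have hg' : g ∈ Submodule.span ℝ (Submonoid.closure s : Set ((ι → unitInterval) →ᵇ ℝ)) := by
      have := StarAlgebra.adjoin_eq_span (R := ℝ) s
      rw [hstar, Set.union_self] at this
      rw [← this]
      exact hg
    clear hg
    induction hg' using Submodule.span_induction with
    | mem g hg =>
      obtain ⟨k, c, hc⟩ := exists_eq_prod_of_mem_closure_unitCubeCoord hg
      simp only [hc, h]
    | zero => simp
    | add f g _ _ hf hg =>
      simp only [BoundedContinuousFunction.coe_add, Pi.add_apply]
      rw [integral_add (f.integrable _) (g.integrable _),
        integral_add (f.integrable _) (g.integrable _), hf, hg]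
    | smul a f _ hf =>
      simp only [BoundedContinuousFunction.coe_smul]
      rw [integral_smul, integral_smul, hf]

variable {S T : Type*} [mS : MeasurableSpace S]

/-- A countable π-system generating a countably generated `σ`-field. -/
def basicSet (S : Type*) [MeasurableSpace S] [MeasurableSpace.CountablyGenerated S]
    (s : Finset ℕ) : Set S :=
  ⋂ i ∈ s, MeasurableSpace.natGeneratingSequence S i

lemma measurableSet_basicSet [MeasurableSpace.CountablyGenerated S] (s : Finset ℕ) :
    MeasurableSet (basicSet S s) :=
  Finset.measurableSet_biInter _ fun _ _ => MeasurableSpace.measurableSet_natGeneratingSequence _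

lemma isPiSystem_range_basicSet [MeasurableSpace.CountablyGenerated S] :
    IsPiSystem (Set.range (basicSet S)) := by
  rintro _ ⟨s, rfl⟩ _ ⟨t, rfl⟩ -
  refine ⟨s ∪ t, ?_⟩
  ext x
  simp only [basicSet, Set.mem_iInter, Set.mem_inter_iff, Finset.mem_union]
  grind

lemma generateFrom_range_basicSet [MeasurableSpace.CountablyGenerated S] :
    mS = MeasurableSpace.generateFrom (Set.range (basicSet S)) := by
  refine le_antisymm ?_ (MeasurableSpace.generateFrom_le ?_)
  · conv_lhs => rw [← MeasurableSpace.generateFrom_natGeneratingSequence S]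
    refine MeasurableSpace.generateFrom_mono ?_
    rintro _ ⟨n, rfl⟩
    exact ⟨{n}, by simp [basicSet]⟩
  · rintro _ ⟨s, rfl⟩
    exact measurableSet_basicSet s

lemma measurable_probabilityMeasure_apply {H : Set S} (hH : MeasurableSet H) :
    Measurable fun p : ProbabilityMeasure S => (p : Measure S) H :=
  (Measure.measurable_coe hH).comp measurable_subtype_coe

lemma measurable_probabilityMeasure_real {H : Set S} (hH : MeasurableSet H) :
    Measurable fun p : ProbabilityMeasure S => (p : Measure S).real H :=
  (measurable_probabilityMeasure_apply hH).ennreal_toReal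

/-- The coordinates of a probability measure along the countable generating π-system. -/
noncomputable def basicCoords [MeasurableSpace.CountablyGenerated S] (p : ProbabilityMeasure S) :
    Finset ℕ → unitInterval :=
  fun s => ⟨(p : Measure S).real (basicSet S s), measureReal_nonneg, measureReal_le_one⟩

lemma measurable_basicCoords [MeasurableSpace.CountablyGenerated S] :
    Measurable (basicCoords (S := S)) :=
  measurable_pi_lambda _ fun s =>
    (measurable_probabilityMeasure_real (measurableSet_basicSet s)).subtype_mk

/-- By the π-λ theorem, measurability of the masses of the basic sets forces measurability of all
evaluations. Passing to the cube therefore loses no measurable set. -/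
lemma comap_basicCoords [MeasurableSpace.CountablyGenerated S] :
    MeasurableSpace.comap (basicCoords (S := S)) inferInstance =
      (inferInstance : MeasurableSpace (ProbabilityMeasure S)) := by
  refine le_antisymm measurable_basicCoords.comap_le ?_
  have key : Measurable[MeasurableSpace.comap (basicCoords (S := S)) inferInstance]
      (fun p : ProbabilityMeasure S => (p : Measure S)) := by
    refine @Measurable.measure_of_isPiSystem_of_isProbabilityMeasure _ _
      (MeasurableSpace.comap (basicCoords (S := S)) inferInstance) _ _ _ _
      generateFrom_range_basicSet isPiSystem_range_basicSet ?_
    rintro _ ⟨s, rfl⟩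
    have h1 : Measurable fun x : Finset ℕ → unitInterval => ENNReal.ofReal (x s : ℝ) := by fun_prop
    convert h1.comp (comap_measurable (basicCoords (S := S))) using 2 with p
    simp [basicCoords]
  exact key.comap_le

/-- A mixture of probability measures is determined by the mixed moments of the masses of the sets
of a countable generating π-system. -/
theorem measure_eq_of_forall_integral_prod_basicSet_eq [mT : MeasurableSpace T]
    [MeasurableSpace.CountablyGenerated S] {L : T → ProbabilityMeasure S}
    (hT : mT = MeasurableSpace.comap L inferInstance) {π₁ π₂ : Measure T}
    [IsFiniteMeasure π₁] [IsFiniteMeasure π₂]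
    (h : ∀ (k : ℕ) (c : Fin k → Finset ℕ),
      ∫ t, ∏ i, (L t : Measure S).real (basicSet S (c i)) ∂π₁ =
        ∫ t, ∏ i, (L t : Measure S).real (basicSet S (c i)) ∂π₂) : π₁ = π₂ := by
  have hL : Measurable L := by rw [hT]; exact comap_measurable L
  have hE : Measurable fun t => basicCoords (L t) := measurable_basicCoords.comp hL
  have key : π₁.map (fun t => basicCoords (L t)) = π₂.map (fun t => basicCoords (L t)) := by
    refine measure_unitCube_ext fun k c => ?_
    rw [integral_map hE.aemeasurable, integral_map hE.aemeasurable]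
    · exact h k c
    all_goals exact (Measurable.aestronglyMeasurable (by fun_prop))
  ext A hA
  -- Every measurable set is a preimage from the cube, so equal images give equal measures; `L` need
  -- not be injective.
  rw [hT, ← comap_basicCoords, MeasurableSpace.comap_comp] at hA
  obtain ⟨D, hD, rfl⟩ := hA
  have := congrArg (fun m => m D) key
  rwa [Measure.map_apply hE hD, Measure.map_apply hE hD] at this

end MomentUniqueness

/-! ### De Finetti's theorem by contractability and an L² argument. -/

section DeFinetti

variable {Ω S : Type*} [MeasurableSpace Ω] [MeasurableSpace S] {P : Measure Ω}
  {Z : ℕ → Ω → S}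

/-- An injection of the first `n` indices extends to a permutation of some larger `Fin N`;
exchangeability there is then projected to `n` coordinates. -/
lemma Exchangeable.map_fin_eq (h : Exchangeable P Z) (hZ : ∀ i, Measurable (Z i)) {ρ : ℕ → ℕ}
    (hρ : ρ.Injective) (n : ℕ) :
    P.map (fun ω (i : Fin n) => Z (ρ i) ω) = P.map (fun ω (i : Fin n) => Z i ω) := by
  classical
  obtain ⟨N, hnN, hN⟩ : ∃ N, n ≤ N ∧ ∀ i < n, ρ i < N := by
    refine ⟨max n ((Finset.range n).sup ρ + 1), le_max_left _ _, fun i hi => ?_⟩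
    exact lt_max_of_lt_right (Nat.lt_succ_of_le (Finset.le_sup (Finset.mem_range.2 hi)))
  let f : Fin N → Fin N := fun i => if hi : (i : ℕ) < n then ⟨ρ i, hN i hi⟩ else i
  obtain ⟨g, hg⟩ := Set.MapsTo.exists_equiv_extend_of_card_eq (t := (Finset.univ : Finset (Fin N)))
    (by simp) (s := {i : Fin N | (i : ℕ) < n}) (f := f) (fun _ _ => by simp) (by
      intro i hi j hj hij
      simp only [Set.mem_ofPred_eq] at hi hj
      simp only [f, hi, hj, dite_true, Fin.mk.injEq] at hij
      exact Fin.ext (hρ hij))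
  let σ : Equiv.Perm (Fin N) := g.trans (Equiv.subtypeUnivEquiv (by simp))
  have hσ : ∀ i : Fin n, ((σ (Fin.castLE hnN i) : Fin N) : ℕ) = ρ i := by
    intro i
    have := hg (Fin.castLE hnN i) (by simp)
    simp [σ, this, f]
  have hr : Measurable fun (x : Fin N → S) (i : Fin n) => x (Fin.castLE hnN i) := by fun_prop
  have := congrArg (fun m => m.map fun (x : Fin N → S) (i : Fin n) => x (Fin.castLE hnN i)) (h N σ)
  rw [Measure.map_map hr (by fun_prop), Measure.map_map hr (by fun_prop)] at this
  simpa [Function.comp_def, hσ] using this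

/-- An exchangeable sequence is contractable. -/
lemma Exchangeable.map_eq [IsFiniteMeasure P] (h : Exchangeable P Z) (hZ : ∀ i, Measurable (Z i))
    {ρ : ℕ → ℕ} (hρ : ρ.Injective) :
    P.map (fun ω i => Z (ρ i) ω) = P.map (fun ω i => Z i ω) := by
  refine IsProjectiveLimit.unique (P := fun I => (P.map fun ω i => Z i ω).map I.restrict)
    (fun I => ?_) (fun I => rfl)
  obtain ⟨n, hn⟩ := I.exists_nat_subset_range
  have hI : ∀ i : I, (i : ℕ) < n := fun i => Finset.mem_range.1 (hn i.2)
  have hr : Measurable fun (x : Fin n → S) (i : I) => x ⟨i, hI i⟩ := by fun_prop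
  have := congrArg (fun m => m.map fun (x : Fin n → S) (i : I) => x ⟨i, hI i⟩)
    (h.map_fin_eq hZ hρ n)
  rw [Measure.map_map hr (by fun_prop), Measure.map_map hr (by fun_prop)] at this
  rw [Measure.map_map (Finset.measurable_restrict I) (by fun_prop)]
  beta_reduce
  rw [Measure.map_map (Finset.measurable_restrict I) (by fun_prop)]
  exact this

/-- The sequence shifted by `n`. -/
def shiftedSeq (Z : ℕ → Ω → S) (n : ℕ) (ω : Ω) : ℕ → S := fun i => Z (n + i) ω

@[fun_prop]
lemma measurable_shiftedSeq (hZ : ∀ i, Measurable (Z i)) (n : ℕ) : Measurable (shiftedSeq Z n) :=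
  measurable_pi_lambda _ fun _ => hZ _

lemma Exchangeable.map_shiftedSeq_prodMk [IsFiniteMeasure P] (h : Exchangeable P Z)
    (hZ : ∀ i, Measurable (Z i)) {j n : ℕ} (hjn : j < n) :
    P.map (fun ω => (shiftedSeq Z n ω, Z j ω)) = P.map (fun ω => (shiftedSeq Z 1 ω, Z 0 ω)) := by
  have key : ∀ {j n : ℕ}, j < n → P.map (fun ω => (shiftedSeq Z n ω, Z j ω)) =
      (P.map (fun ω i => Z i ω)).map (fun x : ℕ → S => (fun i => x (i + 1), x 0)) := by
    intro j n hjn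
    -- Index `0` goes to `j` and the others to the tail from `n`; this is injective precisely
    -- because `j < n`.
    let ρ : ℕ → ℕ := fun i => i.casesOn j fun i => n + i
    have hρ : ρ.Injective := by
      rintro (_ | a) (_ | b) hab
      · rfl
      · exact absurd (show j = n + b from hab) (by omega)
      · exact absurd (show n + a = j from hab) (by omega)
      · exact congrArg _ (Nat.add_left_cancel (show n + a = n + b from hab))
    rw [← h.map_eq hZ hρ, Measure.map_map (by fun_prop) (by fun_prop)]
    rfl
  rw [key hjn, key zero_lt_one]

lemma Exchangeable.map_shiftedSeq [IsFiniteMeasure P] (h : Exchangeable P Z)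
    (hZ : ∀ i, Measurable (Z i)) (n : ℕ) :
    P.map (shiftedSeq Z n) = P.map (shiftedSeq Z 1) :=
  (h.map_eq hZ (ρ := fun i => n + i) (add_right_injective n)).trans
    (h.map_eq hZ (ρ := fun i => 1 + i) (add_right_injective 1)).symm

/-- Expanding the square gives `E(a - b)² = 0`. This is the fact that a vector whose projection has
the same norm equals its projection. -/
lemma ae_eq_of_lintegral_mul_eq [IsProbabilityMeasure P] {a b : Ω → ℝ≥0∞} (ha : Measurable a) (hb : Measurable b)
    (ha1 : ∀ ω, a ω ≤ 1) (hb1 : ∀ ω, b ω ≤ 1)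
    (haa : ∫⁻ ω, a ω * a ω ∂P = ∫⁻ ω, b ω * b ω ∂P)
    (hab : ∫⁻ ω, a ω * b ω ∂P = ∫⁻ ω, b ω * b ω ∂P) : a =ᵐ[P] b := by
  have hint : ∀ {u v : Ω → ℝ≥0∞}, Measurable u → Measurable v → (∀ ω, u ω ≤ 1) → (∀ ω, v ω ≤ 1) →
      Integrable (fun ω => (u ω).toReal * (v ω).toReal) P ∧
      ∫ ω, (u ω).toReal * (v ω).toReal ∂P = (∫⁻ ω, u ω * v ω ∂P).toReal := by
    intro u v hu hv hu1 hv1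
    have h1 : ∀ ω, u ω * v ω ≤ 1 := fun ω => mul_le_one' (hu1 ω) (hv1 ω)
    simp_rw [← ENNReal.toReal_mul]
    refine ⟨integrable_toReal_of_lintegral_ne_top (hu.mul hv).aemeasurable
      (ne_top_of_le_ne_top ENNReal.one_ne_top ?_), integral_toReal (hu.mul hv).aemeasurable
      (ae_of_all _ fun ω => (h1 ω).trans_lt ENNReal.one_lt_top)⟩
    exact (lintegral_mono h1).trans (by simp)
  obtain ⟨iaa, eaa⟩ := hint ha ha ha1 ha1
  obtain ⟨iab, eab⟩ := hint ha hb ha1 hb1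
  obtain ⟨ibb, ebb⟩ := hint hb hb hb1 hb1
  have hexp : ∀ ω, ((a ω).toReal - (b ω).toReal) ^ 2 = (a ω).toReal * (a ω).toReal -
      2 * ((a ω).toReal * (b ω).toReal) + (b ω).toReal * (b ω).toReal := fun ω => by ring
  have h0 : ∫ ω, ((a ω).toReal - (b ω).toReal) ^ 2 ∂P = 0 := by
    have h1 := integral_add (iaa.sub (iab.const_mul 2)) ibb
    have h2 := integral_sub iaa (iab.const_mul 2)
    simp only [Pi.sub_apply] at h1
    simp_rw [hexp]
    rw [h1, h2, integral_const_mul, eaa, eab, ebb, haa, hab]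
    ring
  rw [integral_eq_zero_iff_of_nonneg (fun _ => sq_nonneg _)] at h0
  · filter_upwards [h0] with ω hω
    have : (a ω).toReal = (b ω).toReal := by simpa [sub_eq_zero] using hω
    exact (ENNReal.toReal_eq_toReal_iff' (ne_top_of_le_ne_top ENNReal.one_ne_top (ha1 ω))
      (ne_top_of_le_ne_top ENNReal.one_ne_top (hb1 ω))).1 this
  · simp_rw [hexp]
    exact (iaa.sub (iab.const_mul 2)).add ibb

variable [StandardBorelSpace S] [Nonempty S] [IsProbabilityMeasure P]

/-- The conditional law of `Z 0` given a value of `Z 1, Z 2, …`. -/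
noncomputable def nextLaw (P : Measure Ω) [IsProbabilityMeasure P] (Z : ℕ → Ω → S) :
    Kernel (ℕ → S) S :=
  condDistrib (Z 0) (shiftedSeq Z 1) P

instance : IsMarkovKernel (nextLaw P Z) := by unfold nextLaw; infer_instance

lemma Exchangeable.lintegral_shiftedSeq (h : Exchangeable P Z) (hZ : ∀ i, Measurable (Z i))
    {j n : ℕ} (hjn : j < n) {F : (ℕ → S) × S → ℝ≥0∞} (hF : Measurable F) :
    ∫⁻ ω, F (shiftedSeq Z n ω, Z j ω) ∂P =
      ∫⁻ ω, ∫⁻ z, F (shiftedSeq Z n ω, z) ∂(nextLaw P Z (shiftedSeq Z n ω)) ∂P := by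
  have h1 : P.map (fun ω => (shiftedSeq Z n ω, Z j ω)) =
      P.map (shiftedSeq Z n) ⊗ₘ nextLaw P Z := by
    rw [h.map_shiftedSeq_prodMk hZ hjn, h.map_shiftedSeq hZ n, nextLaw,
      compProd_map_condDistrib (hZ 0).aemeasurable]
  have hθ : Measurable (shiftedSeq Z n) := measurable_shiftedSeq hZ n
  rw [← lintegral_map (f := F) hF (hθ.prodMk (hZ j)), h1, Measure.lintegral_compProd hF,
    lintegral_map hF.lintegral_kernel_prod_right' hθ]

lemma Exchangeable.lintegral_indicator_mul (h : Exchangeable P Z) (hZ : ∀ i, Measurable (Z i))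
    {j n : ℕ} (hjn : j < n) {H : Set S} (hH : MeasurableSet H) {G : (ℕ → S) → ℝ≥0∞}
    (hG : Measurable G) :
    ∫⁻ ω, H.indicator 1 (Z j ω) * G (shiftedSeq Z n ω) ∂P =
      ∫⁻ ω, nextLaw P Z (shiftedSeq Z n ω) H * G (shiftedSeq Z n ω) ∂P := by
  have h1 : Measurable (H.indicator (1 : S → ℝ≥0∞)) := measurable_one.indicator hH
  rw [h.lintegral_shiftedSeq hZ hjn (F := fun x => H.indicator 1 x.2 * G x.1) (by fun_prop)]
  simp_rw [lintegral_mul_const _ h1, lintegral_indicator_one hH]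

/-- With `a` and `b` the two sides, `E a² = E b²` since the tails have the same law. Moreover `E ab`
and `E b²` both equal `E[1_H(Z 0) b]`, by conditioning `Z 0` on the tail from `1` and on the tail
from `n`. -/
lemma Exchangeable.nextLaw_apply_ae_eq (h : Exchangeable P Z) (hZ : ∀ i, Measurable (Z i))
    {n : ℕ} (hn : 0 < n) {H : Set S} (hH : MeasurableSet H) :
    ∀ᵐ ω ∂P, nextLaw P Z (shiftedSeq Z 1 ω) H = nextLaw P Z (shiftedSeq Z n ω) H := by
  have hκ : Measurable fun x => nextLaw P Z x H := (nextLaw P Z).measurable_coe hH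
  have h1 : Measurable (shiftedSeq Z 1) := measurable_shiftedSeq hZ 1
  have hn' : Measurable (shiftedSeq Z n) := measurable_shiftedSeq hZ n
  refine ae_eq_of_lintegral_mul_eq (hκ.comp h1) (hκ.comp hn') (fun _ => prob_le_one)
    (fun _ => prob_le_one) ?_ ?_
  · have hκ' : Measurable fun x => nextLaw P Z x H * nextLaw P Z x H := hκ.mul hκ
    change ∫⁻ ω, (fun x => nextLaw P Z x H * nextLaw P Z x H) (shiftedSeq Z 1 ω) ∂P = _
    rw [← lintegral_map hκ' h1, ← h.map_shiftedSeq hZ n, lintegral_map hκ' hn']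
  · rw [← h.lintegral_indicator_mul hZ hn hH (G := fun x => nextLaw P Z x H) hκ]
    -- The tail from `n` is a function of the tail from `1`, so `b` is an admissible weight when
    -- conditioning on the latter.
    have hs : ∀ ω, shiftedSeq Z n ω = fun i => shiftedSeq Z 1 ω (n - 1 + i) := by
      intro ω
      ext i
      simp only [shiftedSeq]
      congr 1
      omega
    simp_rw [hs]
    exact (h.lintegral_indicator_mul hZ zero_lt_one hH
      (G := fun x => nextLaw P Z (fun i => x (n - 1 + i)) H) (hκ.comp (by fun_prop))).symm

/-- The law of the next observation, as a random element of the space of probability measures. -/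
noncomputable def nextProb (P : Measure Ω) [IsProbabilityMeasure P] (Z : ℕ → Ω → S)
    (x : ℕ → S) : ProbabilityMeasure S :=
  ⟨nextLaw P Z x, inferInstance⟩

@[fun_prop]
lemma measurable_nextProb : Measurable (nextProb P Z) :=
  (nextLaw P Z).measurable.subtype_mk

/-- The directing random measure of an exchangeable sequence. -/
noncomputable def directingMeasure (P : Measure Ω) [IsProbabilityMeasure P] (Z : ℕ → Ω → S)
    (ω : Ω) : ProbabilityMeasure S :=
  nextProb P Z (shiftedSeq Z 1 ω)

lemma measurable_directingMeasure (hZ : ∀ i, Measurable (Z i)) :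
    Measurable (directingMeasure P Z) :=
  measurable_nextProb.comp (measurable_shiftedSeq hZ 1)

lemma Exchangeable.directingMeasure_ae_eq (h : Exchangeable P Z) (hZ : ∀ i, Measurable (Z i))
    {n : ℕ} (hn : 0 < n) : ∀ᵐ ω ∂P, directingMeasure P Z ω = nextProb P Z (shiftedSeq Z n ω) := by
  have : ∀ᵐ ω ∂P, ∀ s : Finset ℕ, nextLaw P Z (shiftedSeq Z 1 ω) (basicSet S s) =
      nextLaw P Z (shiftedSeq Z n ω) (basicSet S s) :=
    ae_all_iff.2 fun s => h.nextLaw_apply_ae_eq hZ hn (measurableSet_basicSet s)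
  filter_upwards [this] with ω hω
  refine Subtype.ext ?_
  change nextLaw P Z (shiftedSeq Z 1 ω) = nextLaw P Z (shiftedSeq Z n ω)
  refine ext_of_generate_finite _ generateFrom_range_basicSet isPiSystem_range_basicSet ?_ ?_
  · rintro _ ⟨s, rfl⟩
    exact hω s
  · simp

/-- **De Finetti's theorem**: an exchangeable sequence is conditionally i.i.d. given its directing
random measure. -/
theorem Exchangeable.lintegral_prod_indicator_mul (h : Exchangeable P Z)
    (hZ : ∀ i, Measurable (Z i)) (k n : ℕ) {H : Fin k → Set S} (hH : ∀ i, MeasurableSet (H i))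
    {w : ProbabilityMeasure S → ℝ≥0∞} (hw : Measurable w) :
    ∫⁻ ω, (∏ i, (H i).indicator 1 (Z (n + i) ω)) * w (directingMeasure P Z ω) ∂P =
      ∫⁻ ω, (∏ i, (directingMeasure P Z ω : Measure S) (H i)) * w (directingMeasure P Z ω) ∂P := by
  -- Each step writes the directing measure as a function of the tail from `n + 1`, so that only one
  -- factor involves `Z n`. That factor is integrated out and the resulting mass is absorbed into
  -- `w`, which is why `w` must vary.
  induction k generalizing n w with
  | zero => simp
  | succ k ih =>
    have hind : ∀ i, Measurable ((H i).indicator (1 : S → ℝ≥0∞)) :=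
      fun i => measurable_one.indicator (hH i)
    have hp := measurable_probabilityMeasure_apply (hH 0)
    have hae := h.directingMeasure_ae_eq hZ n.succ_pos
    calc
      _ = ∫⁻ ω, (H 0).indicator 1 (Z n ω) * ((∏ i : Fin k,
            (H i.succ).indicator 1 (shiftedSeq Z (n + 1) ω i)) *
              w (nextProb P Z (shiftedSeq Z (n + 1) ω))) ∂P := by
        refine lintegral_congr_ae (hae.mono fun ω hω => ?_)
        simp only [Fin.prod_univ_succ, Fin.val_zero, add_zero, Fin.val_succ, shiftedSeq, mul_assoc]
        rw [hω]
        simp only [add_assoc, add_comm 1]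
      _ = ∫⁻ ω, nextLaw P Z (shiftedSeq Z (n + 1) ω) (H 0) * ((∏ i : Fin k,
            (H i.succ).indicator 1 (shiftedSeq Z (n + 1) ω i)) *
              w (nextProb P Z (shiftedSeq Z (n + 1) ω))) ∂P := by
        refine h.lintegral_indicator_mul hZ n.lt_succ_self (hH 0)
          (G := fun x => (∏ i : Fin k, (H i.succ).indicator 1 (x i)) * w (nextProb P Z x)) ?_
        refine Measurable.mul (Finset.measurable_prod _ fun i _ => ?_) (hw.comp measurable_nextProb)
        exact (hind i.succ).comp (measurable_pi_apply _)
      _ = ∫⁻ ω, (∏ i : Fin k, (H i.succ).indicator 1 (Z (n + 1 + i) ω)) *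
            ((directingMeasure P Z ω : Measure S) (H 0) * w (directingMeasure P Z ω)) ∂P := by
        refine lintegral_congr_ae (hae.mono fun ω hω => ?_)
        simp only
        rw [hω]
        simp only [shiftedSeq, nextProb, ProbabilityMeasure.coe_mk]
        ring
      _ = _ := by
        rw [ih (n + 1) (fun i => hH i.succ) (w := fun p => (p : Measure S) (H 0) * w p)
          (hp.mul hw)]
        refine lintegral_congr fun ω => ?_
        rw [Fin.prod_univ_succ]
        ring

end DeFinetti

/-! ### Product integrals, conditional probabilities, and equality of measures as a measurable
condition. -/

section Auxiliary

lemma preimage_observations_pi {Ω S : Type*} (Z : ℕ → Ω → S) {n : ℕ} (H : Fin n → Set S) :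
    observations Z n ⁻¹' Set.univ.pi H = ⋂ i : Fin n, Z i ⁻¹' H i := by
  ext ω
  simp [observations]

variable {Ω S : Type*} [MeasurableSpace S]

lemma measure_pi_ext_of_box {n : ℕ} {m₁ m₂ : Measure (Fin n → S)} [IsFiniteMeasure m₁]
    (h : ∀ H : Fin n → Set S, (∀ i, MeasurableSet (H i)) →
      m₁ (Set.univ.pi H) = m₂ (Set.univ.pi H)) : m₁ = m₂ := by
  refine ext_of_generate_finite _ generateFrom_pi.symm isPiSystem_pi ?_ ?_
  · rintro _ ⟨H, hH, rfl⟩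
    exact h H fun i => hH i (Set.mem_univ i)
  · simpa using h (fun _ => Set.univ) fun _ => MeasurableSet.univ

lemma lintegral_pi_prod_eq_prod {n : ℕ} (m : Measure S) [IsProbabilityMeasure m]
    {u : Fin n → S → ℝ≥0∞} (hu : ∀ i, Measurable (u i)) :
    ∫⁻ z, ∏ i, u i (z i) ∂(Measure.pi fun _ : Fin n => m) = ∏ i, ∫⁻ x, u i x ∂m := by
  rw [lintegral_prod_eq_prod_lintegral_of_indepFun Finset.univ (fun i (z : Fin n → S) => u i (z i))
    (iIndepFun_pi fun i => (hu i).aemeasurable) fun i => (hu i).comp (measurable_pi_apply i)]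
  refine Finset.prod_congr rfl fun i _ => ?_
  exact (measurePreserving_eval (fun _ : Fin n => m) i).lintegral_comp (hu i)

variable [mΩ : MeasurableSpace Ω] {P : Measure Ω}

lemma measurable_observations {Z : ℕ → Ω → S} (hZ : ∀ i, Measurable (Z i)) (n : ℕ) :
    Measurable (observations Z n) :=
  measurable_pi_lambda _ fun _ => hZ _

lemma setLIntegral_iInter_preimage {k : ℕ} {Y : Fin k → Ω → S} (hY : ∀ i, Measurable (Y i))
    {H : Fin k → Set S} (hH : ∀ i, MeasurableSet (H i)) (u : Ω → ℝ≥0∞) :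
    ∫⁻ ω in ⋂ i, Y i ⁻¹' H i, u ω ∂P = ∫⁻ ω, (∏ i, (H i).indicator 1 (Y i ω)) * u ω ∂P := by
  rw [← lintegral_indicator (MeasurableSet.iInter fun i => hY i (hH i))]
  refine lintegral_congr fun ω => ?_
  by_cases hω : ω ∈ ⋂ i, Y i ⁻¹' H i
  · rw [Set.indicator_of_mem hω, Finset.prod_eq_one, one_mul]
    intro i _
    exact Set.indicator_of_mem (M := ℝ≥0∞) (Set.mem_iInter.1 hω i) 1
  · rw [Set.indicator_of_notMem hω]
    obtain ⟨i, hi⟩ : ∃ i, Y i ω ∉ H i := by simpa using hω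
    rw [Finset.prod_eq_zero (Finset.mem_univ i) (Set.indicator_of_notMem hi _), zero_mul]

/-- Trades real conditional expectations for `ℝ≥0∞` integral identities; the bound by `1` makes
`toReal` lossless. -/
lemma condExp_indicator_ae_eq_toReal_iff [IsProbabilityMeasure P] {m : MeasurableSpace Ω}
    (hm : m ≤ mΩ) {A : Set Ω} (hA : MeasurableSet[mΩ] A) {g : Ω → ℝ≥0∞} (hg : Measurable[m] g)
    (hg1 : ∀ ω, g ω ≤ 1) :
    (P⟦A | m⟧ =ᵐ[P] fun ω => (g ω).toReal) ↔
      ∀ s, MeasurableSet[m] s → P (A ∩ s) = ∫⁻ ω in s, g ω ∂P := by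
  have hfin : ∀ s, ∫⁻ ω in s, g ω ∂P ≠ ∞ := fun s =>
    ne_top_of_le_ne_top (measure_ne_top P s) ((lintegral_mono hg1).trans (by simp))
  have hg' : Measurable[mΩ] g := hg.mono hm le_rfl
  have hreal : ∀ s, ∫ ω in s, (g ω).toReal ∂P = (∫⁻ ω in s, g ω ∂P).toReal := fun s =>
    integral_toReal hg'.aemeasurable (ae_of_all _ fun ω => (hg1 ω).trans_lt ENNReal.one_lt_top)
  have hint : Integrable (fun ω => (g ω).toReal) P :=
    integrable_toReal_of_lintegral_ne_top hg'.aemeasurable (by simpa using hfin Set.univ)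
  have hintA : Integrable (A.indicator fun _ => (1 : ℝ)) P := (integrable_const 1).indicator hA
  have hindA : ∀ s, MeasurableSet[m] s →
      ∫ ω in s, A.indicator (fun _ => (1 : ℝ)) ω ∂P = (P (A ∩ s)).toReal := fun s _ => by
    rw [setIntegral_indicator hA, setIntegral_const, smul_eq_mul, mul_one, Set.inter_comm]
    rfl
  constructor
  · intro h s hs
    have h1 := setIntegral_condExp hm hintA hs
    rw [hindA s hs, setIntegral_congr_ae (g := fun ω => (g ω).toReal) (hm s hs)
      (h.mono fun ω hω _ => hω), hreal] at h1
    exact ((ENNReal.toReal_eq_toReal_iff' (hfin s) (measure_ne_top _ _)).1 h1).symm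
  · intro h
    refine (ae_eq_condExp_of_forall_setIntegral_eq hm hintA (fun s _ _ => hint.integrableOn)
      (fun s hs _ => ?_) hg.ennreal_toReal.stronglyMeasurable.aestronglyMeasurable).symm
    rw [hindA s hs, hreal, h s hs]

/-- Equality of probability measures amounts to countably many scalar equations, one for each basic
set. -/
lemma measurableSet_setOf_measure_eq {T : Type*} [MeasurableSpace T]
    [MeasurableSpace.CountablyGenerated S] {L : T → Measure S} [∀ t, IsProbabilityMeasure (L t)]
    (hL : Measurable L) (m : Measure S) [IsProbabilityMeasure m] :
    MeasurableSet {t | L t = m} := by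
  have : {t | L t = m} = ⋂ s : Finset ℕ, {t | L t (basicSet S s) = m (basicSet S s)} := by
    ext t
    simp only [Set.mem_ofPred_eq, Set.mem_iInter]
    refine ⟨fun h s => by rw [h], fun h => ?_⟩
    refine ext_of_generate_finite _ generateFrom_range_basicSet isPiSystem_range_basicSet ?_
      (by simp)
    rintro _ ⟨s, rfl⟩
    exact h s
  rw [this]
  exact MeasurableSet.iInter fun s =>
    ((Measure.measurable_coe (measurableSet_basicSet s)).comp hL) (measurableSet_singleton _)

end Auxiliary

/-! ### Existence and uniqueness of the prior. -/

section Prior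

variable {Ω S : Type*} [MeasurableSpace Ω] [MeasurableSpace S] {P : Measure Ω} {Z : ℕ → Ω → S}

lemma integral_prod_real_eq {T : Type*} [MeasurableSpace T] {m : Measure T}
    {L : T → ProbabilityMeasure S} (hL : Measurable L) {k : ℕ} {H : Fin k → Set S}
    (hH : ∀ i, MeasurableSet (H i)) :
    ∫ t, ∏ i, (L t : Measure S).real (H i) ∂m =
      (∫⁻ t, ∏ i, (L t : Measure S) (H i) ∂m).toReal := by
  rw [← integral_toReal]
  · simp [Measure.real, ENNReal.toReal_prod]
  · exact (Finset.measurable_prod _ fun i _ =>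
      (measurable_probabilityMeasure_apply (hH i)).comp hL).aemeasurable
  · exact ae_of_all _ fun t => (Finset.prod_le_one' fun i _ => prob_le_one).trans_lt
      ENNReal.one_lt_top

lemma IsPrior.eq [MeasurableSpace.CountablyGenerated S] {π₁ π₂ : Measure (ProbabilityMeasure S)}
    (h₁ : IsPrior P Z π₁) (h₂ : IsPrior P Z π₂) : π₁ = π₂ := by
  have := h₁.1
  have := h₂.1
  refine measure_eq_of_forall_integral_prod_basicSet_eq (L := id) MeasurableSpace.comap_id.symm
    fun k c => ?_
  have hc : ∀ i, MeasurableSet (basicSet S (c i)) := fun i => measurableSet_basicSet _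
  rw [integral_prod_real_eq measurable_id hc, integral_prod_real_eq measurable_id hc]
  simp only [id]
  rw [← h₁.2 k _ hc, ← h₂.2 k _ hc]

lemma Exchangeable.setLIntegral_iInter [StandardBorelSpace S] [Nonempty S]
    [IsProbabilityMeasure P] (h : Exchangeable P Z) (hZ : ∀ i, Measurable (Z i)) {k : ℕ}
    {H : Fin k → Set S} (hH : ∀ i, MeasurableSet (H i)) {w : ProbabilityMeasure S → ℝ≥0∞}
    (hw : Measurable w) :
    ∫⁻ ω in ⋂ i : Fin k, Z i ⁻¹' H i, w (directingMeasure P Z ω) ∂P =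
      ∫⁻ ω, (∏ i, (directingMeasure P Z ω : Measure S) (H i)) * w (directingMeasure P Z ω) ∂P := by
  rw [setLIntegral_iInter_preimage (fun i => hZ i) hH]
  simpa using h.lintegral_prod_indicator_mul hZ k 0 hH hw

lemma Exchangeable.isPrior_map_directingMeasure [StandardBorelSpace S] [Nonempty S]
    [IsProbabilityMeasure P] (h : Exchangeable P Z) (hZ : ∀ i, Measurable (Z i)) :
    IsPrior P Z (P.map (directingMeasure P Z)) := by
  have hp := measurable_directingMeasure (P := P) hZ
  refine ⟨Measure.isProbabilityMeasure_map hp.aemeasurable, fun k H hH => ?_⟩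
  rw [lintegral_map (Finset.measurable_prod _ fun i _ =>
    measurable_probabilityMeasure_apply (hH i)) hp]
  simpa using h.setLIntegral_iInter hZ hH (w := fun _ => 1) measurable_const

end Prior

/-! ### Fréchet densities and the measurability of `P₀`. -/

section Density

variable {X Y : Type*} [MeasurableSpace X] [MeasurableSpace Y] {μ : Measure X} {ν : Measure Y}

@[fun_prop]
lemma FrechetDensity.measurable_law :
    Measurable (FrechetDensity.law : FrechetDensity μ ν → ProbabilityMeasure (X × Y)) :=
  comap_measurable _

lemma FrechetDensity.measurable_law_apply {H : Set (X × Y)} (hH : MeasurableSet H) :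
    Measurable fun g : FrechetDensity μ ν => (g.law : Measure (X × Y)) H :=
  (measurable_probabilityMeasure_apply hH).comp FrechetDensity.measurable_law

lemma FrechetDensity.coe_law (g : FrechetDensity μ ν) :
    (g.law : Measure (X × Y)) = (μ.prod ν).withDensity fun z => (g.eval z : ℝ≥0∞) := rfl

lemma FrechetDensity.measurable_eval (g : FrechetDensity μ ν) : Measurable g.eval :=
  g.1.measurable_toFun

lemma FrechetDensity.law_mem_frechetClassAC (g : FrechetDensity μ ν) :
    g.law ∈ FrechetClassAC μ ν :=
  ⟨g.2, withDensity_absolutelyContinuous _ _⟩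

/-- The Radon–Nikodym derivative is finite a.e., so truncating it to `ℝ≥0` does not change the
measure. -/
lemma exists_law_eq_of_mem_frechetClassAC [IsProbabilityMeasure μ] [IsProbabilityMeasure ν]
    {p : ProbabilityMeasure (X × Y)} (hp : p ∈ FrechetClassAC μ ν) :
    ∃ g : FrechetDensity μ ν, g.law = p := by
  have hae : (fun z => (((p : Measure (X × Y)).rnDeriv (μ.prod ν) z).toNNReal : ℝ≥0∞))
      =ᵐ[μ.prod ν] (p : Measure (X × Y)).rnDeriv (μ.prod ν) := by
    filter_upwards [Measure.rnDeriv_ne_top (p : Measure (X × Y)) (μ.prod ν)] with z hz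
    exact ENNReal.coe_toNNReal hz
  have hdens : (μ.prod ν).withDensity
      (fun z => (((p : Measure (X × Y)).rnDeriv (μ.prod ν) z).toNNReal : ℝ≥0∞)) = p := by
    rw [withDensity_congr_ae hae, Measure.withDensity_rnDeriv_eq _ _ hp.2]
  let g : ProdDensity μ ν :=
    { toFun := fun z => ((p : Measure (X × Y)).rnDeriv (μ.prod ν) z).toNNReal
      measurable_toFun := (Measure.measurable_rnDeriv _ _).ennreal_toNNReal
      lintegral_eq_one := by
        rw [← setLIntegral_univ, ← withDensity_apply _ MeasurableSet.univ, hdens, measure_univ] }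
  have hg : g.law = p := Subtype.ext hdens
  exact ⟨⟨g, by rw [hg]; exact hp.1⟩, hg⟩

lemma measurableSet_frechetClassAC [StandardBorelSpace X] [StandardBorelSpace Y]
    [IsProbabilityMeasure μ] [IsProbabilityMeasure ν] :
    MeasurableSet (FrechetClassAC μ ν) := by
  have hcoe : Measurable fun p : ProbabilityMeasure (X × Y) => (p : Measure (X × Y)) :=
    measurable_subtype_coe
  -- Viewing `p ↦ p` as a kernel makes absolute continuity a measurable condition on `p`.
  let K : Kernel (ProbabilityMeasure (X × Y)) (X × Y) := ⟨fun p => p, hcoe⟩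
  have : IsMarkovKernel K := ⟨fun p => p.2⟩
  have h1 : ∀ p : ProbabilityMeasure (X × Y),
      IsProbabilityMeasure ((p : Measure (X × Y)).map Prod.fst) :=
    fun p => Measure.isProbabilityMeasure_map measurable_fst.aemeasurable
  have h2 : ∀ p : ProbabilityMeasure (X × Y),
      IsProbabilityMeasure ((p : Measure (X × Y)).map Prod.snd) :=
    fun p => Measure.isProbabilityMeasure_map measurable_snd.aemeasurable
  exact ((measurableSet_setOf_measure_eq
    (L := fun p : ProbabilityMeasure (X × Y) => (p : Measure (X × Y)).map Prod.fst)
    ((Measure.measurable_map _ measurable_fst).comp hcoe)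
    μ).inter (measurableSet_setOf_measure_eq
    (L := fun p : ProbabilityMeasure (X × Y) => (p : Measure (X × Y)).map Prod.snd)
    ((Measure.measurable_map _ measurable_snd).comp hcoe)
    ν)).inter (Kernel.measurableSet_absolutelyContinuous K (Kernel.const _ (μ.prod ν)))

/-- A measurable choice of densities. -/
lemma exists_measurable_density [StandardBorelSpace X] [StandardBorelSpace Y]
    [IsProbabilityMeasure μ] [IsProbabilityMeasure ν] :
    ∃ e : ProbabilityMeasure (X × Y) → FrechetDensity μ ν, Measurable e ∧
      ∀ p ∈ FrechetClassAC μ ν, (e p).law = p := by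
  classical
  let p₀ : ProbabilityMeasure (X × Y) := ⟨μ.prod ν, inferInstance⟩
  have hp₀ : p₀ ∈ FrechetClassAC μ ν := by
    refine ⟨⟨?_, ?_⟩, Measure.AbsolutelyContinuous.rfl⟩
    · simp [p₀]
    · simp [p₀]
  have : ∀ p, ∃ g : FrechetDensity μ ν, g.law = if p ∈ FrechetClassAC μ ν then p else p₀ := by
    intro p
    refine exists_law_eq_of_mem_frechetClassAC ?_
    split_ifs with h
    exacts [h, hp₀]
  -- No selection theorem is needed: an arbitrary choice is measurable once its composition with
  -- `law` is. Off `P₀` the default is `μ × ν`, which lies in `P₀`.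
  choose e he using this
  refine ⟨e, measurable_comap_iff.2 ?_, fun p hp => by rw [he, if_pos hp]⟩
  rw [show FrechetDensity.law ∘ e = _ from funext he]
  exact Measurable.ite measurableSet_frechetClassAC measurable_id measurable_const

end Density

/-! ### Conditionally i.i.d. sequences and random densities. -/

section CondIID

variable {Ω X Y : Type*} [mΩ : MeasurableSpace Ω] [MeasurableSpace X] [MeasurableSpace Y]
  {μ : Measure X} {ν : Measure Y} {P : Measure Ω} [IsProbabilityMeasure P] {Z : ℕ → Ω → X × Y}
  {f : Ω → FrechetDensity μ ν}

lemma measurable_prod_law_apply {k : ℕ} {H : Fin k → Set (X × Y)}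
    (hH : ∀ i, MeasurableSet (H i)) :
    Measurable fun g : FrechetDensity μ ν => ∏ i, (g.law : Measure (X × Y)) (H i) :=
  Finset.measurable_prod _ fun i _ => FrechetDensity.measurable_law_apply (hH i)

lemma prod_law_apply_le_one {k : ℕ} (H : Fin k → Set (X × Y)) (g : FrechetDensity μ ν) :
    ∏ i, (g.law : Measure (X × Y)) (H i) ≤ 1 :=
  Finset.prod_le_one' fun _ _ => prob_le_one

lemma isCondIID_iff (hZ : ∀ i, Measurable (Z i)) :
    IsCondIID P Z f ↔ Measurable f ∧
      ∀ (k : ℕ) (H : Fin k → Set (X × Y)), (∀ i, MeasurableSet (H i)) →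
        ∀ B : Set (FrechetDensity μ ν), MeasurableSet B →
          P ((⋂ i : Fin k, Z i ⁻¹' H i) ∩ f ⁻¹' B) =
            ∫⁻ ω in f ⁻¹' B, ∏ i, ((f ω).law : Measure (X × Y)) (H i) ∂P := by
  refine and_congr_right fun hf => forall_congr' fun k => forall_congr' fun H =>
    forall_congr' fun hH => ?_
  have h := condExp_indicator_ae_eq_toReal_iff (P := P) hf.comap_le
    (MeasurableSet.iInter fun i : Fin k => hZ i (hH i))
    ((measurable_prod_law_apply hH).comp (comap_measurable f))
    (fun ω => prod_law_apply_le_one H (f ω))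
  simp only [Function.comp_apply, ENNReal.toReal_prod] at h
  refine h.trans ⟨fun h B hB => h _ ⟨B, hB, rfl⟩, ?_⟩
  rintro h _ ⟨B, hB, rfl⟩
  exact h B hB

/-- The identity on events `f ∈ B` says that two measures have the same image under `f`, so it
extends to all weights `w (f ω)`. -/
lemma IsCondIID.setLIntegral_iInter (h : IsCondIID P Z f) (hZ : ∀ i, Measurable (Z i)) {k : ℕ}
    {H : Fin k → Set (X × Y)} (hH : ∀ i, MeasurableSet (H i)) {w : FrechetDensity μ ν → ℝ≥0∞}
    (hw : Measurable w) :
    ∫⁻ ω in ⋂ i : Fin k, Z i ⁻¹' H i, w (f ω) ∂P =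
      ∫⁻ ω, (∏ i, ((f ω).law : Measure (X × Y)) (H i)) * w (f ω) ∂P := by
  have hf := h.1
  have hprod : Measurable fun ω => ∏ i, ((f ω).law : Measure (X × Y)) (H i) :=
    (measurable_prod_law_apply hH).comp hf
  have key : (P.restrict (⋂ i : Fin k, Z i ⁻¹' H i)).map f =
      (P.withDensity fun ω => ∏ i, ((f ω).law : Measure (X × Y)) (H i)).map f := by
    ext B hB
    rw [Measure.map_apply hf hB, Measure.map_apply hf hB, Measure.restrict_apply (hf hB),
      withDensity_apply _ (hf hB), Set.inter_comm]
    exact ((isCondIID_iff hZ).1 h).2 k H hH B hB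
  rw [← lintegral_map hw hf, key, lintegral_map hw hf]
  exact lintegral_withDensity_eq_lintegral_mul _ hprod (hw.comp hf)

lemma IsCondIID.measure_iInter (h : IsCondIID P Z f) (hZ : ∀ i, Measurable (Z i)) {k : ℕ}
    {H : Fin k → Set (X × Y)} (hH : ∀ i, MeasurableSet (H i)) :
    P (⋂ i : Fin k, Z i ⁻¹' H i) = ∫⁻ ω, ∏ i, ((f ω).law : Measure (X × Y)) (H i) ∂P := by
  simpa using h.setLIntegral_iInter hZ hH (w := fun _ => 1) measurable_const

lemma IsCondIID.isPrior (h : IsCondIID P Z f) (hZ : ∀ i, Measurable (Z i)) :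
    IsPrior P Z (P.map fun ω => (f ω).law) := by
  have hL : Measurable fun ω => (f ω).law := FrechetDensity.measurable_law.comp h.1
  refine ⟨Measure.isProbabilityMeasure_map hL.aemeasurable, fun k H hH => ?_⟩
  rw [lintegral_map (Finset.measurable_prod _ fun i _ =>
    measurable_probabilityMeasure_apply (hH i)) hL]
  exact h.measure_iInter hZ hH

lemma IsCondIID.exchangeable (h : IsCondIID P Z f) (hZ : ∀ i, Measurable (Z i)) :
    Exchangeable P Z := by
  intro n σ
  have h1 : Measurable fun ω (i : Fin n) => Z (σ i) ω := measurable_pi_lambda _ fun _ => hZ _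
  have h2 : Measurable fun ω (i : Fin n) => Z i ω := measurable_pi_lambda _ fun _ => hZ _
  have : IsProbabilityMeasure (P.map fun ω (i : Fin n) => Z (σ i) ω) :=
    Measure.isProbabilityMeasure_map h1.aemeasurable
  refine measure_pi_ext_of_box fun H hH => ?_
  have hbox := MeasurableSet.univ_pi hH
  rw [Measure.map_apply h1 hbox, Measure.map_apply h2 hbox]
  have e1 : (fun ω (i : Fin n) => Z (σ i) ω) ⁻¹' Set.univ.pi H =
      ⋂ i : Fin n, Z i ⁻¹' H (σ.symm i) := by
    ext ω
    simp only [Set.mem_preimage, Set.mem_univ_pi, Set.mem_iInter]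
    exact ⟨fun h i => by simpa using h (σ.symm i), fun h i => by simpa using h (σ i)⟩
  rw [e1, h.measure_iInter hZ fun i => hH _]
  have e2 := h.measure_iInter hZ hH
  rw [← preimage_observations_pi] at e2
  refine Eq.trans ?_ e2.symm
  refine lintegral_congr fun ω => ?_
  exact Equiv.prod_comp σ.symm fun i => ((f ω).law : Measure (X × Y)) (H i)

/-- The random density is the chosen density of the directing measure. Uniqueness of the prior
identifies `Pr` with the law of that measure, which therefore lies in `P₀` a.s. -/
theorem Exchangeable.exists_isCondIID [StandardBorelSpace X] [StandardBorelSpace Y]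
    [IsProbabilityMeasure μ] [IsProbabilityMeasure ν] (h : Exchangeable P Z)
    (hZ : ∀ i, Measurable (Z i)) {Pr : Measure (ProbabilityMeasure (X × Y))}
    (hPr : IsPrior P Z Pr) (hAC : Pr (FrechetClassAC μ ν) = 1) :
    ∃ f : Ω → FrechetDensity μ ν, IsCondIID P Z f := by
  have : Nonempty Ω := nonempty_of_isProbabilityMeasure P
  have : Nonempty (X × Y) := this.map (Z 0)
  obtain ⟨e, he, hlaw⟩ := exists_measurable_density (μ := μ) (ν := ν)
  have hp := measurable_directingMeasure (P := P) hZ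
  have hae : ∀ᵐ ω ∂P, (e (directingMeasure P Z ω)).law = directingMeasure P Z ω := by
    rw [hPr.eq (h.isPrior_map_directingMeasure hZ),
      Measure.map_apply hp measurableSet_frechetClassAC] at hAC
    have := (prob_compl_eq_zero_iff (hp measurableSet_frechetClassAC)).2 hAC
    filter_upwards [measure_eq_zero_iff_ae_notMem.1 this] with ω hω
    exact hlaw _ (by simpa using hω)
  refine ⟨fun ω => e (directingMeasure P Z ω), (isCondIID_iff hZ).2
    ⟨he.comp hp, fun k H hH B hB => ?_⟩⟩
  have hB' : MeasurableSet ((fun ω => e (directingMeasure P Z ω)) ⁻¹' B) := he.comp hp hB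
  have key := h.setLIntegral_iInter hZ hH (w := (e ⁻¹' B).indicator 1)
    (measurable_one.indicator (he hB))
  have e1 : ∀ ω, (e ⁻¹' B).indicator (1 : ProbabilityMeasure (X × Y) → ℝ≥0∞) (directingMeasure P Z ω) =
      ((fun ω => e (directingMeasure P Z ω)) ⁻¹' B).indicator 1 ω := fun ω => rfl
  simp_rw [e1] at key
  rw [lintegral_indicator_one hB', Measure.restrict_apply hB', Set.inter_comm] at key
  refine key.trans ?_
  rw [← lintegral_indicator hB']
  refine lintegral_congr_ae (hae.mono fun ω hω => ?_)
  by_cases hωB : e (directingMeasure P Z ω) ∈ B <;> simp [hω, hωB]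

end CondIID

/-! ### Posteriors: almost sure uniqueness, and construction by disintegration. -/

section Posterior

/-- Both kernels have the same predictive probabilities, hence the same mixed moments. Only
countably many moments are needed, so one null set suffices. -/
lemma IsPosterior.ae_eq {Ω X Y : Type*} [MeasurableSpace Ω] [MeasurableSpace X]
    [MeasurableSpace Y] {μ : Measure X} {ν : Measure Y} {P : Measure Ω} {Z : ℕ → Ω → X × Y} {n : ℕ}
    [MeasurableSpace.CountablyGenerated (X × Y)]
    {Q Q' : Kernel (Fin n → X × Y) (FrechetDensity μ ν)}
    (h : IsPosterior P Z n Q) (h' : IsPosterior P Z n Q') :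
    ∀ᵐ ω ∂P, Q (observations Z n ω) = Q' (observations Z n ω) := by
  have := h.1
  have := h'.1
  have key : ∀ᵐ ω ∂P, ∀ c : (Σ k : ℕ, Fin k → Finset ℕ),
      ∫ g, ∏ i, (g.law : Measure (X × Y)).real (basicSet (X × Y) (c.2 i))
        ∂(Q (observations Z n ω)) =
      ∫ g, ∏ i, (g.law : Measure (X × Y)).real (basicSet (X × Y) (c.2 i))
        ∂(Q' (observations Z n ω)) := by
    refine ae_all_iff.2 fun c => ?_
    have hc : ∀ i, MeasurableSet (basicSet (X × Y) (c.2 i)) := fun i => measurableSet_basicSet _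
    exact (h.2 c.1 _ hc).symm.trans (h'.2 c.1 _ hc)
  filter_upwards [key] with ω hω
  exact measure_eq_of_forall_integral_prod_basicSet_eq (L := FrechetDensity.law) rfl
    fun k c => hω ⟨k, c⟩

variable {Ω X Y : Type*} [mΩ : MeasurableSpace Ω] [MeasurableSpace X] [MeasurableSpace Y]
  {μ : Measure X} {ν : Measure Y} {P : Measure Ω} [IsProbabilityMeasure P] {Z : ℕ → Ω → X × Y}
  {f : Ω → FrechetDensity μ ν} {n : ℕ}

/-- The observed and the future variables are conditionally independent given the density. -/
lemma IsCondIID.measure_future_inter (h : IsCondIID P Z f) (hZ : ∀ i, Measurable (Z i)) {k : ℕ}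
    {H : Fin k → Set (X × Y)} (hH : ∀ i, MeasurableSet (H i)) {C : Set (Fin n → X × Y)}
    (hC : MeasurableSet C) :
    P ((⋂ i : Fin k, Z (n + i) ⁻¹' H i) ∩ observations Z n ⁻¹' C) =
      ∫⁻ ω in observations Z n ⁻¹' C, ∏ i, ((f ω).law : Measure (X × Y)) (H i) ∂P := by
  have ho := measurable_observations hZ n
  have hw := measurable_prod_law_apply (μ := μ) (ν := ν) hH
  have key : (P.restrict (⋂ i : Fin k, Z (n + i) ⁻¹' H i)).map (observations Z n) =
      (P.withDensity fun ω => ∏ i, ((f ω).law : Measure (X × Y)) (H i)).map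
        (observations Z n) := by
    refine measure_pi_ext_of_box fun C hC => ?_
    have hbox := MeasurableSet.univ_pi hC
    rw [Measure.map_apply ho hbox, Measure.map_apply ho hbox, Measure.restrict_apply (ho hbox),
      withDensity_apply _ (ho hbox), preimage_observations_pi, h.setLIntegral_iInter hZ hC hw]
    -- A box for the past and a box for the future form one box for `n + k` variables, whose
    -- conditional probability factors.
    have e1 := h.measure_iInter hZ (k := n + k) (H := Fin.addCases C H)
      (fun i => by refine Fin.addCases (fun i => ?_) (fun i => ?_) i <;> simp [hC, hH])
    simp only [Fin.prod_univ_add, Fin.addCases_left, Fin.addCases_right] at e1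
    rw [← e1]
    congr 1
    ext ω
    simp [Fin.forall_fin_add]
  have := congrArg (fun m => m C) key
  rwa [Measure.map_apply ho hC, Measure.map_apply ho hC, Measure.restrict_apply (ho hC),
    withDensity_apply _ (ho hC), Set.inter_comm] at this

/-- A regular conditional distribution of the random density given the observations is a
posterior. -/
lemma IsCondIID.isPosterior_of_map_eq_compProd (h : IsCondIID P Z f) (hZ : ∀ i, Measurable (Z i))
    {Q : Kernel (Fin n → X × Y) (FrechetDensity μ ν)} [IsMarkovKernel Q]
    (hQ : P.map (fun ω => (observations Z n ω, f ω)) = P.map (observations Z n) ⊗ₘ Q) :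
    IsPosterior P Z n Q := by
  have ho := measurable_observations hZ n
  refine ⟨inferInstance, fun k H hH => ?_⟩
  have hw := measurable_prod_law_apply (μ := μ) (ν := ν) hH
  have hg : Measurable fun z => ∫⁻ g, ∏ i, (g.law : Measure (X × Y)) (H i) ∂(Q z) :=
    hw.lintegral_kernel
  simp_rw [integral_prod_real_eq FrechetDensity.measurable_law hH]
  refine (condExp_indicator_ae_eq_toReal_iff (P := P) ho.comap_le
    (MeasurableSet.iInter fun i : Fin k => hZ (n + i) (hH i))
    (hg.comp (comap_measurable (observations Z n)))
    (fun ω => (lintegral_mono (prod_law_apply_le_one H)).trans (by simp))).2 ?_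
  rintro _ ⟨C, hC, rfl⟩
  rw [h.measure_future_inter hZ hH hC]
  let F : (Fin n → X × Y) × FrechetDensity μ ν → ℝ≥0∞ := fun x =>
    (C ×ˢ Set.univ).indicator (fun x => ∏ i, (x.2.law : Measure (X × Y)) (H i)) x
  have hF : Measurable F := (hw.comp measurable_snd).indicator (hC.prod MeasurableSet.univ)
  have e1 := lintegral_map (μ := P) hF (ho.prodMk h.1)
  rw [hQ, Measure.lintegral_compProd hF, lintegral_map hF.lintegral_kernel_prod_right' ho] at e1
  rw [← lintegral_indicator (ho hC), ← lintegral_indicator (ho hC)]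
  refine Eq.trans ?_ (e1.symm.trans ?_) <;> refine lintegral_congr fun ω => ?_
  · by_cases hω : observations Z n ω ∈ C <;> simp [F, hω]
  · by_cases hω : observations Z n ω ∈ C <;> simp [F, hω]

end Posterior

/-! ### Likelihoods and Bayes' formula. -/

section Bayes

variable {Ω X Y : Type*} [mΩ : MeasurableSpace Ω] [MeasurableSpace X] [MeasurableSpace Y]
  {μ : Measure X} {ν : Measure Y} {Pr : Measure (FrechetDensity μ ν)}
  {φ : FrechetDensity μ ν → X × Y → ℝ≥0} {n : ℕ}

/-- The kernel `g ↦ P_g` has a jointly measurable density with respect to the constant kernel `μ ×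
ν`; it agrees a.e. with `g` for every `g`. -/
lemma exists_isJointVersion [MeasurableSpace.CountablyGenerated (X × Y)]
    [IsProbabilityMeasure μ] [IsProbabilityMeasure ν] : ∃ φ, IsJointVersion Pr φ := by
  let K : Kernel (FrechetDensity μ ν) (X × Y) :=
    ⟨fun g => g.law, measurable_subtype_coe.comp FrechetDensity.measurable_law⟩
  have : IsMarkovKernel K := ⟨fun g => g.law.2⟩
  refine ⟨fun g z => (Kernel.rnDeriv K (Kernel.const _ (μ.prod ν)) g z).toNNReal,
    (Kernel.measurable_rnDeriv _ _).ennreal_toNNReal, ae_of_all _ fun g => ?_⟩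
  have h1 := Kernel.rnDeriv_eq_rnDeriv_measure (κ := K) (η := Kernel.const _ (μ.prod ν)) (a := g)
  rw [Kernel.const_apply] at h1
  have h2 := Measure.rnDeriv_withDensity (μ.prod ν) g.measurable_eval.coe_nnreal_ennreal
  filter_upwards [h1, h2] with z hz1 hz2
  have : (K g).rnDeriv (μ.prod ν) z = g.eval z := hz2
  rw [hz1, this, ENNReal.toNNReal_coe]

lemma measurable_likelihood (hφ : Measurable (Function.uncurry φ)) :
    Measurable fun x : (Fin n → X × Y) × FrechetDensity μ ν => likelihood φ x.1 x.2 := by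
  refine Measurable.coe_nnreal_ennreal (Finset.measurable_prod _ fun i _ => ?_)
  exact hφ.comp (measurable_snd.prodMk ((measurable_pi_apply i).comp measurable_fst))

/-- On a box the integrand is a product of functions of separate coordinates, so the integral
factors; each factor ignores the null set where `φ g` and `g` differ. -/
lemma setLIntegral_likelihood [IsProbabilityMeasure μ] [IsProbabilityMeasure ν]
    (hφ : Measurable (Function.uncurry φ)) {g : FrechetDensity μ ν}
    (hg : φ g =ᵐ[μ.prod ν] g.eval) {H : Fin n → Set (X × Y)} (hH : ∀ i, MeasurableSet (H i)) :
    ∫⁻ z in Set.univ.pi H, likelihood φ z g ∂(Measure.pi fun _ => μ.prod ν) =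
      ∏ i, (g.law : Measure (X × Y)) (H i) := by
  have hφg : Measurable fun z => (φ g z : ℝ≥0∞) :=
    (hφ.comp measurable_prodMk_left).coe_nnreal_ennreal
  have e : ∀ i, (g.law : Measure (X × Y)) (H i) =
      ∫⁻ x, (H i).indicator (fun x => (φ g x : ℝ≥0∞)) x ∂(μ.prod ν) := by
    intro i
    rw [lintegral_indicator (hH i), g.coe_law, withDensity_apply _ (hH i)]
    refine lintegral_congr_ae (ae_restrict_of_ae (hg.mono fun x hx => ?_))
    simp only [hx]
  rw [← lintegral_indicator (MeasurableSet.univ_pi hH)]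
  simp_rw [e]
  rw [← lintegral_pi_prod_eq_prod _ fun i => hφg.indicator (hH i)]
  refine lintegral_congr fun z => ?_
  by_cases hz : z ∈ Set.univ.pi H
  · rw [Set.indicator_of_mem hz, likelihood, ENNReal.ofNNReal_finsetProd]
    refine Finset.prod_congr rfl fun i _ => ?_
    rw [Set.indicator_of_mem (hz i (Set.mem_univ i))]
  · rw [Set.indicator_of_notMem hz]
    obtain ⟨i, hi⟩ : ∃ i, z i ∉ H i := by simpa using hz
    exact (Finset.prod_eq_zero (Finset.mem_univ i) (Set.indicator_of_notMem hi _)).symm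

/-- The joint law of the observations and the random density has the likelihood as its density. -/
lemma IsCondIID.map_observations_prodMk [IsProbabilityMeasure μ] [IsProbabilityMeasure ν]
    {P : Measure Ω} [IsProbabilityMeasure P] {Z : ℕ → Ω → X × Y} {f : Ω → FrechetDensity μ ν}
    (h : IsCondIID P Z f) (hZ : ∀ i, Measurable (Z i)) (hφ : IsJointVersion (P.map f) φ) (n : ℕ) :
    P.map (fun ω => (observations Z n ω, f ω)) =
      ((Measure.pi fun _ : Fin n => μ.prod ν).prod (P.map f)).withDensity
        fun x => likelihood φ x.1 x.2 := by
  have hf := h.1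
  have ho := measurable_observations hZ n
  have hPr : IsProbabilityMeasure (P.map f) := Measure.isProbabilityMeasure_map hf.aemeasurable
  have hl := measurable_likelihood (n := n) hφ.1
  have hfin : IsProbabilityMeasure (P.map fun ω => (observations Z n ω, f ω)) :=
    Measure.isProbabilityMeasure_map (ho.prodMk hf).aemeasurable
  refine Measure.ext_prod fun {C B} hC hB => ?_
  -- With `B` fixed, it suffices to test boxes in the observations, where Tonelli reduces the claim
  -- to a single `g`.
  have key : (P.restrict (f ⁻¹' B)).map (observations Z n) =
      (Measure.pi fun _ : Fin n => μ.prod ν).withDensity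
        fun z => ∫⁻ g in B, likelihood φ z g ∂(P.map f) := by
    refine measure_pi_ext_of_box fun H hH => ?_
    have hbox := MeasurableSet.univ_pi hH
    rw [Measure.map_apply ho hbox, Measure.restrict_apply (ho hbox), preimage_observations_pi,
      ((isCondIID_iff hZ).1 h).2 n H hH B hB, withDensity_apply _ hbox,
      lintegral_lintegral_swap hl.aemeasurable,
      ← setLIntegral_map hB (measurable_prod_law_apply hH) hf]
    refine lintegral_congr_ae (ae_restrict_of_ae (hφ.2.mono fun g hg => ?_))
    exact (setLIntegral_likelihood hφ.1 hg hH).symm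
  have e := congrArg (fun m => m C) key
  rw [Measure.map_apply ho hC, Measure.restrict_apply (ho hC), withDensity_apply _ hC] at e
  rw [Measure.map_apply (ho.prodMk hf) (hC.prod hB), withDensity_apply _ (hC.prod hB),
    ← Measure.prod_restrict, lintegral_prod _ hl.aemeasurable]
  exact e

/-- The normalising constant in Bayes' formula. -/
noncomputable def evidence (Pr : Measure (FrechetDensity μ ν))
    (φ : FrechetDensity μ ν → X × Y → ℝ≥0) {n : ℕ} (z : Fin n → X × Y) : ℝ≥0∞ :=
  ∫⁻ g, likelihood φ z g ∂Pr

lemma measurable_evidence [SFinite Pr] (hφ : Measurable (Function.uncurry φ)) :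
    Measurable (evidence (n := n) Pr φ) :=
  (measurable_likelihood hφ).lintegral_prod_right'

open Classical in
/-- The right-hand side of Bayes' formula, and the prior where that is not defined. -/
noncomputable def bayesMeasure (Pr : Measure (FrechetDensity μ ν))
    (φ : FrechetDensity μ ν → X × Y → ℝ≥0) {n : ℕ} (z : Fin n → X × Y) :
    Measure (FrechetDensity μ ν) :=
  if evidence Pr φ z ∈ Set.Ioo 0 ∞ then
    (evidence Pr φ z)⁻¹ • Pr.withDensity (likelihood φ z) else Pr

lemma measurable_bayesMeasure [SFinite Pr] (hφ : Measurable (Function.uncurry φ)) :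
    Measurable (bayesMeasure (n := n) Pr φ) := by
  classical
  have hL := measurable_evidence (n := n) (Pr := Pr) hφ
  refine Measurable.ite (hL measurableSet_Ioo) ?_ measurable_const
  refine Measure.measurable_of_measurable_coe _ fun B hB => ?_
  simp only [Measure.smul_apply, smul_eq_mul, withDensity_apply _ hB]
  exact hL.inv.mul (measurable_likelihood hφ).lintegral_prod_right'

lemma isProbabilityMeasure_bayesMeasure [IsProbabilityMeasure Pr] (z : Fin n → X × Y) :
    IsProbabilityMeasure (bayesMeasure Pr φ z) := by
  unfold bayesMeasure
  split_ifs with hz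
  · constructor
    rw [Measure.smul_apply, withDensity_apply _ MeasurableSet.univ, Measure.restrict_univ,
      smul_eq_mul]
    exact ENNReal.inv_mul_cancel hz.1.ne' hz.2.ne
  · infer_instance

/-- If the evidence vanishes, so does the right-hand side, and the fallback to the prior does no
harm. -/
lemma evidence_mul_bayesMeasure {z : Fin n → X × Y} (hz : evidence Pr φ z ≠ ∞)
    {B : Set (FrechetDensity μ ν)} (hB : MeasurableSet B) :
    evidence Pr φ z * bayesMeasure Pr φ z B = ∫⁻ g in B, likelihood φ z g ∂Pr := by
  rcases eq_or_ne (evidence Pr φ z) 0 with h0 | h0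
  · rw [h0, zero_mul]
    exact (le_antisymm ((setLIntegral_le_lintegral _ _).trans h0.le) zero_le).symm
  · rw [bayesMeasure, if_pos ⟨h0.bot_lt, hz.lt_top⟩, Measure.smul_apply, withDensity_apply _ hB,
      smul_eq_mul, ← mul_assoc, ENNReal.mul_inv_cancel h0 hz, one_mul]

/-- **Bayes' formula**, as a kernel. -/
noncomputable def bayesKernel (Pr : Measure (FrechetDensity μ ν)) [SFinite Pr]
    {φ : FrechetDensity μ ν → X × Y → ℝ≥0} (hφ : Measurable (Function.uncurry φ)) (n : ℕ) :
    Kernel (Fin n → X × Y) (FrechetDensity μ ν) :=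
  ⟨bayesMeasure Pr φ, measurable_bayesMeasure hφ⟩

theorem IsCondIID.isPosterior_bayesKernel [IsProbabilityMeasure μ] [IsProbabilityMeasure ν]
    {P : Measure Ω} [IsProbabilityMeasure P] {Z : ℕ → Ω → X × Y} {f : Ω → FrechetDensity μ ν}
    (h : IsCondIID P Z f) (hZ : ∀ i, Measurable (Z i)) (hφ : IsJointVersion (P.map f) φ) (n : ℕ) :
    IsPosterior P Z n (bayesKernel (P.map f) hφ.1 n) := by
  have hf := h.1
  have ho := measurable_observations hZ n
  have hPr : IsProbabilityMeasure (P.map f) := Measure.isProbabilityMeasure_map hf.aemeasurable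
  have hQ : IsMarkovKernel (bayesKernel (P.map f) hφ.1 n) :=
    ⟨fun z => isProbabilityMeasure_bayesMeasure z⟩
  have hl := measurable_likelihood (n := n) hφ.1
  have hL := measurable_evidence (n := n) (Pr := P.map f) hφ.1
  have hfin : IsProbabilityMeasure (P.map fun ω => (observations Z n ω, f ω)) :=
    Measure.isProbabilityMeasure_map (ho.prodMk hf).aemeasurable
  have hjoint := h.map_observations_prodMk hZ hφ n
  have hrect : ∀ C : Set (Fin n → X × Y), ∀ B : Set (FrechetDensity μ ν), MeasurableSet C →
      MeasurableSet B → P.map (fun ω => (observations Z n ω, f ω)) (C ×ˢ B) =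
        ∫⁻ z in C, ∫⁻ g in B, likelihood φ z g ∂(P.map f) ∂(Measure.pi fun _ => μ.prod ν) := by
    intro C B hC hB
    rw [hjoint, withDensity_apply _ (hC.prod hB), ← Measure.prod_restrict,
      lintegral_prod _ hl.aemeasurable]
  have hobs : P.map (observations Z n) =
      (Measure.pi fun _ => μ.prod ν).withDensity (evidence (P.map f) φ) := by
    ext C hC
    have := hrect C Set.univ hC MeasurableSet.univ
    rw [Measure.map_apply (ho.prodMk hf) (hC.prod MeasurableSet.univ)] at this
    rw [Measure.map_apply ho hC, withDensity_apply _ hC]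
    simpa [Set.mk_preimage_prod, evidence] using this
  -- The evidence is the density of the law of the observations; its integral is `1`, so it is
  -- finite a.e.
  have hne : ∀ᵐ z ∂(Measure.pi fun _ : Fin n => μ.prod ν), evidence (P.map f) φ z ≠ ∞ := by
    have hone : ∫⁻ z, evidence (P.map f) φ z ∂(Measure.pi fun _ : Fin n => μ.prod ν) = 1 := by
      rw [← setLIntegral_univ, ← withDensity_apply _ MeasurableSet.univ, ← hobs,
        Measure.map_apply ho MeasurableSet.univ]
      simp
    filter_upwards [ae_lt_top hL (by rw [hone]; exact ENNReal.one_ne_top)] with z hz using hz.ne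
  refine h.isPosterior_of_map_eq_compProd hZ (Measure.ext_prod fun {C B} hC hB => ?_)
  rw [hrect C B hC hB, Measure.compProd_apply_prod hC hB, hobs,
    setLIntegral_withDensity_eq_setLIntegral_mul _ hL (Kernel.measurable_coe _ hB) hC]
  refine lintegral_congr_ae (ae_restrict_of_ae (hne.mono fun z hz => ?_))
  exact (evidence_mul_bayesMeasure hz hB).symm

end Bayes

theorem mainTheorem1 {Ω X Y : Type*} [MeasurableSpace Ω] (P : Measure Ω) [IsProbabilityMeasure P]
    [MeasurableSpace X] [StandardBorelSpace X] [MeasurableSpace Y] [StandardBorelSpace Y]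
    (μ : Measure X) [IsProbabilityMeasure μ] (ν : Measure Y) [IsProbabilityMeasure ν]
    (Z : ℕ → Ω → X × Y) (hZ : ∀ i, Measurable (Z i)) :
    -- an exchangeable sequence has exactly one prior
    (Exchangeable P Z → ∃! Pr : Measure (ProbabilityMeasure (X × Y)), IsPrior P Z Pr) ∧
    -- exchangeable with prior concentrated on `P₀` iff conditionally i.i.d. given a random density
    ((Exchangeable P Z ∧ ∃ Pr : Measure (ProbabilityMeasure (X × Y)),
        IsPrior P Z Pr ∧ Pr (FrechetClassAC μ ν) = 1) ↔
      ∃ f : Ω → FrechetDensity μ ν, IsCondIID P Z f) ∧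
    -- Bayes' formula
    (∀ f : Ω → FrechetDensity μ ν, IsCondIID P Z f →
      (∃ φ, IsJointVersion (P.map f) φ) ∧
      ∀ n : ℕ,
        (∃ Q : Kernel (Fin n → X × Y) (FrechetDensity μ ν), IsPosterior P Z n Q) ∧
        ∀ φ, IsJointVersion (P.map f) φ →
        ∀ Q : Kernel (Fin n → X × Y) (FrechetDensity μ ν), IsPosterior P Z n Q →
          ∀ᵐ ω ∂P,
            (∫⁻ g, likelihood φ (observations Z n ω) g ∂(P.map f)) ∈ Set.Ioo 0 ∞ →
              Q (observations Z n ω) =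
                (∫⁻ g, likelihood φ (observations Z n ω) g ∂(P.map f))⁻¹ •
                  (P.map f).withDensity (likelihood φ (observations Z n ω))) := by
  have : Nonempty Ω := nonempty_of_isProbabilityMeasure P
  have : Nonempty (X × Y) := this.map (Z 0)
  refine ⟨fun h => ⟨_, h.isPrior_map_directingMeasure hZ, fun Pr hPr =>
    hPr.eq (h.isPrior_map_directingMeasure hZ)⟩, ⟨?_, ?_⟩, fun f h => ?_⟩
  · rintro ⟨h, Pr, hPr, hAC⟩
    exact h.exists_isCondIID hZ hPr hAC
  · rintro ⟨f, h⟩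
    refine ⟨h.exchangeable hZ, _, h.isPrior hZ, ?_⟩
    have hL : Measurable fun ω => (f ω).law := FrechetDensity.measurable_law.comp h.1
    rw [Measure.map_apply hL measurableSet_frechetClassAC]
    have : (fun ω => (f ω).law) ⁻¹' FrechetClassAC μ ν = Set.univ :=
      Set.eq_univ_of_forall fun ω => (f ω).law_mem_frechetClassAC
    rw [this, measure_univ]
  · have : IsProbabilityMeasure (P.map f) := Measure.isProbabilityMeasure_map h.1.aemeasurable
    obtain ⟨φ₀, hφ₀⟩ := exists_isJointVersion (Pr := P.map f)
    refine ⟨⟨φ₀, hφ₀⟩, fun n => ⟨⟨_, h.isPosterior_bayesKernel hZ hφ₀ n⟩, fun φ hφ Q hQ => ?_⟩⟩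
    -- The comparison kernel is built from the given `φ`, so its first branch is literally the
    -- claimed formula.
    filter_upwards [hQ.ae_eq (h.isPosterior_bayesKernel hZ hφ n)] with ω hω hL
    exact hω.trans (if_pos hL)
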